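/- Let $\mathbf T=(\mathbb R\cup\{-\infty\},\ \oplus=\max,\ \odot=+)$ be the tropical semifield. Let $\overline{\mathbf T[X_1,\dots,X_n]}$ be the quotient of the tropical polynomial semiring by the congruence identifying two polynomials that define the same function on $\mathbf T^n$, and let $\overline{\mathbf T(X_1,\dots,X_n)}$ be its semifield of fractions. Every element $f$ of it has a value $f(x)\in\mathbf T$ at each $x\in\mathbb R^n$. A congruence on a commutative semiring $S$ is an equivalence relation $E\subset S\times S$ compatible with addition and multiplication; $\langle G\rangle$ denotes the smallest congruence containing $G\subset S\times S$, and $E$ is finitely generated if $E=\langle G\rangle$ for some finite $G$. Write $f\ge g$ if $f\oplus g=f$. For $V\subset\mathbb R^n$ put $$\mathbf E(V)=\{(f,g)\in\overline{\mathbf T(X_1,\dots,X_n)}^2 \mid f(x)=g(x)\ \text{for all } x\in V\},$$ which is a congruence. An $\mathbb R$-rational polyhedral set in $\mathbb R^n$ is the solution set of a finite system of linear inequalities whose coefficients, except for the constant terms, are rational (the constant terms are arbitrary real numbers). **Theorem.** Let $n\ge 0$ and let $V$ be any subset of $\mathbb R^n$, with Euclidean closure $\overline V$. 1. $\mathbf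 E(V)$ is finitely generated as a congruence if and only if $\overline V$ is a finite union of $\mathbb R$-rational polyhedral sets. 2. If $\overline V$ is a finite union of $\mathbb R$-rational polyhedral sets and $V\neq\varnothing$, then there is $f\in\overline{\mathbf T(X_1,\dots,X_n)}$ with $f\ge 0$ (here $0$ is the constant function with value the real number $0$) and $\mathbf E(V)=\langle (f,0)\rangle$. 3. Explicitly, suppose $\overline V=\bigcup_{k=1}^p P_k$ with $p\ge 0$, where each $P_k=\{x\in\mathbb R^n\mid c_{kj}\cdot x+a_{kj}\le 0,\ j=1,\dots,m_k\}$ is nonempty, $c_{kj}\in\mathbb Z^n$ and $a_{kj}\in\mathbb R$. Then $\mathbf E(V)=\langle (f,0)\rangle$ for $$f=\Bigl(\bigoplus_{k=1}^p\Bigl(\bigodot_{j=1}^{m_k}\bigl(a_{kj}\odot X_1^{\odot c_{kj,1}}\odot\cdots\odot X_n^{\odot c_{kj,n}}\oplus 0\bigr)\Bigr)^{\odot(-1)}\Bigr)^{\odot(-1)},$$ and $f\ge 0$ if $V\ne\varnothing$. (When $V=\varnothing$, one has $p=0$ and $f=-\infty$, with the convention $(-\infty)^{\odot(-1)}=-\infty$.)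 -/

import Mathlib

/-- The tropical semifield `𝕋 = (ℝ ∪ {-∞}, max, +)`. Mathlib's `Tropical R` is the min-plus
semiring on `R`, so max-plus is obtained by reversing the order of `ℝ` first: the top element
adjoined to `ℝᵒᵈ` is `-∞`, and `min` in `WithTop ℝᵒᵈ` is `max` in `ℝ ∪ {-∞}`. Hence `+` is `⊕`
(maximum), `*` is `⊙` (usual sum), `0` is `-∞` and `1` is the real number `0`;
see `Trop.ofReal_add`, `Trop.ofReal_mul`, `Trop.zero_ne_ofReal`, `Trop.ofReal_zero`. -/
abbrev Trop : Type := Tropical (WithTop ℝᵒᵈ)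

namespace Trop

/-- The inclusion `ℝ ⊂ 𝕋`. -/
def ofReal (r : ℝ) : Trop :=
  Tropical.trop ((OrderDual.toDual r : ℝᵒᵈ) : WithTop ℝᵒᵈ)

theorem ofReal_add (a b : ℝ) : ofReal a + ofReal b = ofReal (max a b) := by
  apply Tropical.untrop_injective
  simp only [ofReal, Tropical.untrop_add, Tropical.untrop_trop]
  rw [← WithTop.coe_min]
  rfl

theorem ofReal_mul (a b : ℝ) : ofReal a * ofReal b = ofReal (a + b) := by
  apply Tropical.untrop_injective
  rfl

theorem ofReal_zero : ofReal 0 = 1 := rfl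

theorem zero_ne_ofReal (a : ℝ) : (0 : Trop) ≠ ofReal a := fun h =>
  WithTop.top_ne_coe (congrArg Tropical.untrop h)

theorem eq_zero_or_eq_ofReal (t : Trop) : t = 0 ∨ ∃ a : ℝ, t = ofReal a := by
  induction t using Tropical.tropRec with
  | h X =>
    induction X using WithTop.recTopCoe with
    | top => exact Or.inl rfl
    | coe a => exact Or.inr ⟨OrderDual.ofDual a, rfl⟩

theorem isUnit_of_ne_zero {t : Trop} (h : t ≠ 0) : IsUnit t := by
  obtain rfl | ⟨a, rfl⟩ := eq_zero_or_eq_ofReal t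
  · exact absurd rfl h
  · refine IsUnit.of_mul_eq_one (ofReal (-a)) ?_
    rw [ofReal_mul, add_neg_cancel, ofReal_zero]

theorem add_eq_zero {a b : Trop} (h : a + b = 0) : a = 0 ∧ b = 0 := by
  obtain rfl | ⟨x, rfl⟩ := eq_zero_or_eq_ofReal a
  · exact ⟨rfl, by simpa using h⟩
  · obtain rfl | ⟨y, rfl⟩ := eq_zero_or_eq_ofReal b
    · exact ⟨by simpa using h, rfl⟩
    · rw [ofReal_add] at h
      exact absurd h.symm (zero_ne_ofReal _)

theorem sum_eq_zero {ι : Type} (s : Finset ι) (f : ι → Trop) (h : ∑ i ∈ s, f i = 0) :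
    ∀ i ∈ s, f i = 0 := by
  classical
  induction s using Finset.induction_on with
  | empty => simp
  | insert a s ha ih =>
    rw [Finset.sum_insert ha] at h
    have h' := add_eq_zero h
    intro i hi
    rcases Finset.mem_insert.mp hi with rfl | hi
    · exact h'.1
    · exact ih h'.2 i hi

/-- A polynomial that is not the zero polynomial is real-valued on `ℝⁿ`. -/
theorem eval_ofReal_ne_zero {n : ℕ} {p : MvPolynomial (Fin n) Trop} (hp : p ≠ 0)
    (x : Fin n → ℝ) : MvPolynomial.eval (fun i => ofReal (x i)) p ≠ 0 := by
  intro h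
  obtain ⟨d, hd⟩ := MvPolynomial.ne_zero_iff.mp hp
  rw [MvPolynomial.eval_eq] at h
  have h' := sum_eq_zero _ _ h d (MvPolynomial.mem_support_iff.mpr hd)
  refine ((isUnit_of_ne_zero hd).mul (IsUnit.prod_iff.mpr fun i _ => ?_)).ne_zero h'
  exact (isUnit_of_ne_zero (zero_ne_ofReal _).symm).pow _

end Trop

/-- The congruence `E(𝕋ⁿ)₀` on the tropical polynomial semiring `𝕋[X₁, …, Xₙ]`: two polynomials
are congruent when they define the same function on `𝕋ⁿ`. -/
noncomputable def samePolyFun (n : ℕ) : RingCon (MvPolynomial (Fin n) Trop) where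
  r f g := ∀ x : Fin n → Trop, MvPolynomial.eval x f = MvPolynomial.eval x g
  iseqv := ⟨fun _ _ => rfl, fun h x => (h x).symm, fun h h' x => (h x).trans (h' x)⟩
  add' h h' x := by rw [map_add, map_add, h x, h' x]
  mul' h h' x := by rw [map_mul, map_mul, h x, h' x]

/-- The tropical polynomial function semiring, `𝕋[X₁, …, Xₙ]` modulo equality of functions
on `𝕋ⁿ`. -/
abbrev TropPolyFun (n : ℕ) : Type := (samePolyFun n).Quotient

namespace TropPolyFun

/-- The value of a tropical polynomial function at a point of `ℝⁿ`. -/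
noncomputable def eval {n : ℕ} (x : Fin n → ℝ) : TropPolyFun n →+* Trop :=
  (samePolyFun n).lift (MvPolynomial.eval fun i => Trop.ofReal (x i)) fun {_ _} h => h _

theorem eval_ne_zero {n : ℕ} {f : TropPolyFun n} (hf : f ≠ 0) (x : Fin n → ℝ) :
    eval x f ≠ 0 := by
  obtain ⟨p, rfl⟩ := (samePolyFun n).mk'_surjective f
  refine Trop.eval_ofReal_ne_zero (p := p) ?_ x
  rintro rfl
  exact hf (map_zero _)

instance instNontrivial (n : ℕ) : Nontrivial (TropPolyFun n) :=
  ⟨⟨0, 1, fun h => by simpa using congrArg (eval fun _ => 0) h⟩⟩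

instance instNoZeroDivisors (n : ℕ) : NoZeroDivisors (TropPolyFun n) where
  eq_zero_or_eq_zero_of_mul_eq_zero {a b} h := by
    by_contra! hab
    have h' := congrArg (eval fun _ => 0) h
    rw [map_mul, map_zero] at h'
    rcases mul_eq_zero.mp h' with h' | h'
    · exact eval_ne_zero hab.1 _ h'
    · exact eval_ne_zero hab.2 _ h'

end TropPolyFun

/-- The tropical rational function semifield: the semifield of fractions of the tropical
polynomial function semiring. (The non-zero-divisors are exactly the nonzero elements, because
there are no zero divisors.) Its `0` is the constant `-∞`, its `1` is the constant `0 ∈ ℝ`. -/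
abbrev TropRat (n : ℕ) : Type := Localization (nonZeroDivisors (TropPolyFun n))

namespace TropRat

noncomputable instance instSemifield (n : ℕ) : Semifield (TropRat n) where
  __ := (inferInstance : CommSemiring (TropRat n))
  __ := (inferInstance : CommGroupWithZero (TropRat n))
  nnqsmul := _
  nnqsmul_def := fun _ _ => rfl

/-- The value of a tropical rational function at a point `x` of `ℝⁿ`: the value of `g / h` is
`g(x) ⊙ h(x)⁻¹`, where `h(x)` is a real number because `h` is not `-∞`. -/
noncomputable def eval {n : ℕ} (x : Fin n → ℝ) : TropRat n →+* Trop :=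
  IsLocalization.lift (M := nonZeroDivisors (TropPolyFun n)) (g := TropPolyFun.eval x) fun y =>
    Trop.isUnit_of_ne_zero (TropPolyFun.eval_ne_zero (nonZeroDivisors.ne_zero y.2) x)

/-- The coordinate function `Xᵢ`. -/
noncomputable def X {n : ℕ} (i : Fin n) : TropRat n :=
  algebraMap (TropPolyFun n) (TropRat n) ((samePolyFun n).mk' (MvPolynomial.X i))

/-- The constant function with real value `a`. -/
noncomputable def const {n : ℕ} (a : ℝ) : TropRat n :=
  algebraMap (TropPolyFun n) (TropRat n)
    ((samePolyFun n).mk' (MvPolynomial.C (Trop.ofReal a)))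

theorem eval_X {n : ℕ} (x : Fin n → ℝ) (i : Fin n) : eval x (X i) = Trop.ofReal (x i) :=
  (IsLocalization.lift_eq _ _).trans (MvPolynomial.eval_X i)

theorem eval_const {n : ℕ} (x : Fin n → ℝ) (a : ℝ) : eval x (const a) = Trop.ofReal a :=
  (IsLocalization.lift_eq _ _).trans (MvPolynomial.eval_C _)

/-- The natural order `f ≥ g` of an idempotent semiring: `f ⊕ g = f`. -/
def Ge {n : ℕ} (f g : TropRat n) : Prop := f + g = f

/-- The congruence `E(V)` associated with a subset `V` of `ℝⁿ`: the pairs of tropical rational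
functions that agree at every point of `V`. -/
noncomputable def congruence {n : ℕ} (V : Set (Fin n → ℝ)) : RingCon (TropRat n) where
  r f g := ∀ x ∈ V, eval x f = eval x g
  iseqv := ⟨fun _ _ _ => rfl, fun h x hx => (h x hx).symm,
    fun h h' x hx => (h x hx).trans (h' x hx)⟩
  add' h h' x hx := by rw [map_add, map_add, h x hx, h' x hx]
  mul' h h' x hx := by rw [map_mul, map_mul, h x hx, h' x hx]

end TropRat

/-- The smallest congruence on the semiring `S` that contains the given set of pairs. -/
def congruenceSpan {S : Type} [CommSemiring S] (G : Set (S × S)) : RingCon S :=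
  ringConGen fun a b => (a, b) ∈ G

/-- A congruence is finitely generated when it is the smallest congruence containing some finite
set of pairs. -/
def CongruenceFG {S : Type} [CommSemiring S] (E : RingCon S) : Prop :=
  ∃ G : Set (S × S), G.Finite ∧ congruenceSpan G = E

/-- The solution set in `ℝⁿ` of the finite system `cⱼ · x + aⱼ ≤ 0`. -/
def polyhedron {n m : ℕ} (c : Fin m → Fin n → ℝ) (a : Fin m → ℝ) : Set (Fin n → ℝ) :=
  {x | ∀ j, ∑ i, c j i * x i + a j ≤ 0}

/-- An `ℝ`-rational polyhedral set: the solution set of a finite system of linear inequalities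
with rational coefficients and arbitrary real constant terms. -/
def IsRationalPolyhedral {n : ℕ} (P : Set (Fin n → ℝ)) : Prop :=
  ∃ (m : ℕ) (c : Fin m → Fin n → ℚ) (a : Fin m → ℝ),
    P = polyhedron (fun j i => (c j i : ℝ)) a

/-- A finite union of `ℝ`-rational polyhedral sets. -/
def IsFiniteUnionRationalPolyhedral {n : ℕ} (W : Set (Fin n → ℝ)) : Prop :=
  ∃ F : Set (Set (Fin n → ℝ)), F.Finite ∧ (∀ P ∈ F, IsRationalPolyhedral P) ∧ W = ⋃₀ F

/-- For `p` finite systems of inequalities `cₖⱼ · x + aₖⱼ ≤ 0` with integral `cₖⱼ`, the tropical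
rational function `(⊕ₖ (⊙ⱼ (aₖⱼ ⊙ X₁^cₖⱼ₁ ⊙ ⋯ ⊙ Xₙ^cₖⱼₙ ⊕ 0))⁻¹)⁻¹`. -/
noncomputable def unionGenerator {n p : ℕ} (m : Fin p → ℕ)
    (c : (k : Fin p) → Fin (m k) → Fin n → ℤ) (a : (k : Fin p) → Fin (m k) → ℝ) : TropRat n :=
  (∑ k, (∏ j, (TropRat.const (a k j) * ∏ i, TropRat.X i ^ c k j i + 1))⁻¹)⁻¹

/-! Suppose finitely many pairs (g, h) generate E(V). Each solution set {g = h} is closed, and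
rational functions separate points from closed sets, so the closure of V is the intersection of
these sets (`closure_eq_of_congruence_eq_span`). Clearing denominators turns g = h into an equality
of two finite maxima of affine functions with integral slopes, whose solutions form a finite union
of rational polyhedral sets.

Conversely, let the closure of V be the union of nonempty P_k. The explicit f has values F(x) =
min_k (total violation at x of the system of P_k), so F ≥ 0 and F = 0 on V. By
`hoffman_error_bound`, dist(x, V) ≤ C · F(x). If u = v on V, with neither equal to -∞, then h = u/v
is Lipschitz and has value 0 on V, so h ≤ N · F for some N, that is, h ⊕ f^N = f^N. Modulo f ~ 1
this gives h ⊕ 1 ~ 1, and likewise h⁻¹ ⊕ 1 ~ 1. Multiplying the latter by h yields 1 ⊕ h ~ h, hence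
h ~ 1 and u ~ v. -/

namespace Trop

/-! ### The order of the tropical semifield -/

theorem ofReal_injective : Function.Injective ofReal := fun a b h => by
  have h := congrArg Tropical.untrop h
  simp only [ofReal, Tropical.untrop_trop] at h
  exact congrArg OrderDual.ofDual (WithTop.coe_injective h)

/-- Inequalities a ≤ b are written `a + b = b` throughout, so that they are equations a congruence
can use. -/
theorem ofReal_add_eq_right {a b : ℝ} : ofReal a + ofReal b = ofReal b ↔ a ≤ b := by
  rw [ofReal_add, ofReal_injective.eq_iff, max_eq_right_iff]

theorem add_add_eq_right_iff {a b t : Trop} : a + b + t = t ↔ a + t = t ∧ b + t = t := by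
  simp only [Tropical.add_eq_right_iff]
  exact ⟨fun h => ⟨h.trans (min_le_left _ _), h.trans (min_le_right _ _)⟩,
    fun h => le_min h.1 h.2⟩

theorem add_eq_right_add_iff {a b c : Trop} :
    a + (b + c) = b + c ↔ a + b = b ∨ a + c = c := by
  simp only [Tropical.add_eq_right_iff]
  exact min_le_iff

theorem sum_add_eq_right_iff {ι : Type} (s : Finset ι) (f : ι → Trop) (t : Trop) :
    ∑ i ∈ s, f i + t = t ↔ ∀ i ∈ s, f i + t = t := by
  classical
  induction s using Finset.induction_on with
  | empty => simp
  | insert a s ha ih =>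
    rw [Finset.sum_insert ha, add_add_eq_right_iff, ih, Finset.forall_mem_insert]

/-- An empty sum is -∞, which only -∞ lies below; hence `ht`. -/
theorem add_sum_eq_right_iff {ι : Type} (s : Finset ι) (f : ι → Trop) {t : Trop} (ht : t ≠ 0) :
    t + ∑ i ∈ s, f i = ∑ i ∈ s, f i ↔ ∃ i ∈ s, t + f i = f i := by
  classical
  induction s using Finset.induction_on with
  | empty => simpa using ht
  | insert a s ha ih =>
    rw [Finset.sum_insert ha, add_eq_right_add_iff, ih, Finset.exists_mem_insert]

theorem eq_iff_add_eq {a b : Trop} : a = b ↔ a + b = b ∧ b + a = a := by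
  constructor
  · rintro rfl
    simp
  · rintro ⟨h, h'⟩
    rw [← h', add_comm, h]

end Trop

/-! ### Rational functions are determined by their values on ℝⁿ -/

namespace TropRat

variable {n : ℕ}

theorem eval_algebraMap (x : Fin n → ℝ) (p : TropPolyFun n) :
    eval x (algebraMap _ (TropRat n) p) = TropPolyFun.eval x p :=
  IsLocalization.lift_eq _ _

theorem exists_mul_eq (f : TropRat n) : ∃ p s : TropPolyFun n, s ≠ 0 ∧
    f * algebraMap _ (TropRat n) s = algebraMap _ (TropRat n) p := by
  obtain ⟨⟨p, s⟩, h⟩ := IsLocalization.surj (nonZeroDivisors (TropPolyFun n)) f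
  exact ⟨p, s, nonZeroDivisors.ne_zero s.2, h⟩

theorem isUnit_algebraMap {s : TropPolyFun n} (hs : s ≠ 0) :
    IsUnit (algebraMap _ (TropRat n) s) :=
  IsLocalization.map_units (TropRat n)
    (⟨s, mem_nonZeroDivisors_of_ne_zero hs⟩ : nonZeroDivisors (TropPolyFun n))

end TropRat

/-- The product `X₁ ⊙ ⋯ ⊙ Xₙ` vanishes on the boundary of `𝕋ⁿ`, so that polynomials agreeing on
`ℝⁿ` become equal as functions on `𝕋ⁿ` after multiplication by it. -/
theorem TropPolyFun.algebraMap_eq_of_eval_eq {n : ℕ} {p q : TropPolyFun n}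
    (h : ∀ x, eval x p = eval x q) :
    algebraMap _ (TropRat n) p = algebraMap _ (TropRat n) q := by
  obtain ⟨p, rfl⟩ := (samePolyFun n).mk'_surjective p
  obtain ⟨q, rfl⟩ := (samePolyFun n).mk'_surjective q
  have h : ∀ x : Fin n → ℝ, MvPolynomial.eval (fun i => Trop.ofReal (x i)) p =
    MvPolynomial.eval (fun i => Trop.ofReal (x i)) q := h
  have key : (samePolyFun n).mk' (∏ i, MvPolynomial.X i) * (samePolyFun n).mk' p =
      (samePolyFun n).mk' (∏ i, MvPolynomial.X i) * (samePolyFun n).mk' q := by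
    rw [← map_mul, ← map_mul]
    refine (RingCon.eq _).mpr fun x => ?_
    rw [map_mul, map_mul, map_prod]
    simp only [MvPolynomial.eval_X]
    by_cases hx : ∃ i, x i = 0
    · obtain ⟨i, hi⟩ := hx
      rw [Finset.prod_eq_zero (Finset.mem_univ i) hi, zero_mul, zero_mul]
    · push Not at hx
      choose y hy using fun i => (Trop.eq_zero_or_eq_ofReal (x i)).resolve_left (hx i)
      obtain rfl : x = fun i => Trop.ofReal (y i) := funext hy
      rw [h y]
  have hne : (samePolyFun n).mk' (∏ i, MvPolynomial.X i) ≠ 0 := fun h0 => by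
    have h0 := congrArg (eval fun _ => 0) h0
    change MvPolynomial.eval _ _ = eval _ 0 at h0
    rw [map_prod, map_zero] at h0
    simp only [MvPolynomial.eval_X, Trop.ofReal_zero, Finset.prod_const_one] at h0
    exact one_ne_zero h0
  have := congrArg (algebraMap _ (TropRat n)) key
  rw [map_mul, map_mul] at this
  exact (TropRat.isUnit_algebraMap hne).mul_left_cancel this

namespace TropRat

variable {n : ℕ}

/-- Cross-multiplication reduces this to polynomials. It turns a pointwise inequality on ℝⁿ into an
identity `f + g = g` in the semifield, available modulo every congruence. -/
theorem eq_of_eval_eq {f g : TropRat n} (h : ∀ x, eval x f = eval x g) : f = g := by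
  obtain ⟨p, s, hs, hf⟩ := f.exists_mul_eq
  obtain ⟨q, t, ht, hg⟩ := g.exists_mul_eq
  have key : algebraMap _ (TropRat n) (p * t) = algebraMap _ (TropRat n) (q * s) := by
    refine TropPolyFun.algebraMap_eq_of_eval_eq fun x => ?_
    rw [← eval_algebraMap, ← eval_algebraMap, map_mul, map_mul (algebraMap _ (TropRat n)) q,
      ← hf, ← hg]
    simp only [map_mul, h x]
    ring
  rw [map_mul, map_mul, ← hf, ← hg, mul_assoc, mul_assoc,
    mul_comm (algebraMap _ (TropRat n) t)] at key
  exact ((isUnit_algebraMap hs).mul (isUnit_algebraMap ht)).mul_right_cancel key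

/-! ### Real-valued representatives and their Lipschitz continuity -/

/-- The tropical rational function `f` takes the real values given by `F`. -/
def Represents (f : TropRat n) (F : (Fin n → ℝ) → ℝ) : Prop :=
  ∀ x, eval x f = Trop.ofReal (F x)

namespace Represents

variable {f g : TropRat n} {F G : (Fin n → ℝ) → ℝ}

theorem eval_eq_iff (hf : Represents f F) (hg : Represents g G) (x : Fin n → ℝ) :
    eval x f = eval x g ↔ F x = G x := by
  rw [hf x, hg x, Trop.ofReal_injective.eq_iff]

theorem ne_zero (hf : Represents f F) : f ≠ 0 := by
  rintro rfl
  have := hf 0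
  rw [map_zero] at this
  exact Trop.zero_ne_ofReal _ this

theorem one : Represents (1 : TropRat n) fun _ => 0 := fun _ => map_one _

theorem X (i : Fin n) : Represents (X i) fun x => x i := fun x => eval_X x i

theorem const (a : ℝ) : Represents (const a : TropRat n) fun _ => a := fun x => eval_const x a

theorem add (hf : Represents f F) (hg : Represents g G) :
    Represents (f + g) fun x => max (F x) (G x) := fun x => by
  rw [map_add, hf x, hg x, Trop.ofReal_add]

theorem mul (hf : Represents f F) (hg : Represents g G) :
    Represents (f * g) fun x => F x + G x := fun x => by
  rw [map_mul, hf x, hg x, Trop.ofReal_mul]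

theorem inv (hf : Represents f F) : Represents f⁻¹ fun x => -F x := fun x => by
  have h : eval x f * eval x f⁻¹ = 1 := by
    rw [← map_mul, mul_inv_cancel₀ hf.ne_zero, map_one]
  refine (Trop.isUnit_of_ne_zero (Trop.zero_ne_ofReal (F x)).symm).mul_left_cancel ?_
  rw [← hf x, h, hf x, Trop.ofReal_mul, add_neg_cancel, Trop.ofReal_zero]

theorem pow (hf : Represents f F) (k : ℕ) : Represents (f ^ k) fun x => k * F x := by
  induction k with
  | zero => simpa using one
  | succ k ih =>
    intro x
    rw [pow_succ, (ih.mul hf) x]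
    push_cast
    ring_nf

theorem zpow (hf : Represents f F) (k : ℤ) : Represents (f ^ k) fun x => k * F x := by
  cases k with
  | ofNat k => simpa using hf.pow k
  | negSucc k =>
    intro x
    rw [zpow_negSucc, (hf.pow (k + 1)).inv x]
    push_cast
    ring_nf

theorem prod {ι : Type} (s : Finset ι) {f : ι → TropRat n} {F : ι → (Fin n → ℝ) → ℝ}
    (h : ∀ i, Represents (f i) (F i)) :
    Represents (∏ i ∈ s, f i) fun x => ∑ i ∈ s, F i x := by
  classical
  induction s using Finset.induction_on with
  | empty => simpa using one
  | insert a s ha ih =>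
    simp only [Finset.prod_insert ha, Finset.sum_insert ha]
    exact (h a).mul ih

theorem sum {ι : Type} {s : Finset ι} (hs : s.Nonempty) {f : ι → TropRat n}
    {F : ι → (Fin n → ℝ) → ℝ} (h : ∀ i, Represents (f i) (F i)) :
    Represents (∑ i ∈ s, f i) fun x => s.sup' hs fun i => F i x := by
  induction hs using Finset.Nonempty.cons_induction with
  | singleton a => simpa using h a
  | cons a s ha hs ih =>
    simp only [Finset.sum_cons, Finset.sup'_cons hs]
    exact (h a).add ih

theorem add_eq_right (hf : Represents f F) (hg : Represents g G) (h : ∀ x, F x ≤ G x) :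
    f + g = g := by
  refine eq_of_eval_eq fun x => ?_
  rw [map_add, hf x, hg x, Trop.ofReal_add_eq_right.mpr (h x)]

end Represents

/-- Constants and coordinates are Lipschitz, and so are maxima and sums of Lipschitz functions. -/
theorem _root_.MvPolynomial.exists_lipschitz_ofReal (p : MvPolynomial (Fin n) Trop) :
    p = 0 ∨ ∃ F : (Fin n → ℝ) → ℝ, (∃ K, LipschitzWith K F) ∧
      ∀ x, MvPolynomial.eval (fun i => Trop.ofReal (x i)) p = Trop.ofReal (F x) := by
  induction p using MvPolynomial.induction_on with
  | C a =>
    obtain rfl | ⟨r, rfl⟩ := Trop.eq_zero_or_eq_ofReal a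
    · exact Or.inl (map_zero _)
    · exact Or.inr ⟨fun _ => r, ⟨0, LipschitzWith.const r⟩, fun x => MvPolynomial.eval_C _⟩
  | add p q hp hq =>
    obtain rfl | ⟨F, ⟨K, hK⟩, hF⟩ := hp
    · simpa using hq
    obtain rfl | ⟨G, ⟨L, hL⟩, hG⟩ := hq
    · exact Or.inr ⟨F, ⟨K, hK⟩, fun x => by rw [add_zero, hF]⟩
    · exact Or.inr ⟨_, ⟨_, hK.max hL⟩, fun x => by rw [map_add, hF, hG, Trop.ofReal_add]⟩
  | mul_X p i hp =>
    obtain rfl | ⟨F, ⟨K, hK⟩, hF⟩ := hp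
    · exact Or.inl (zero_mul _)
    · exact Or.inr ⟨_, ⟨_, hK.add (LipschitzWith.eval i)⟩, fun x => by
        rw [map_mul, hF, MvPolynomial.eval_X, Trop.ofReal_mul]⟩

theorem exists_lipschitz_represents {f : TropRat n} (hf : f ≠ 0) :
    ∃ F, (∃ K, LipschitzWith K F) ∧ Represents f F := by
  obtain ⟨p, s, hs, h⟩ := f.exists_mul_eq
  have main (q : TropPolyFun n) (hq : q ≠ 0) : ∃ F, (∃ K, LipschitzWith K F) ∧
      Represents (algebraMap _ (TropRat n) q) F := by
    obtain ⟨q, rfl⟩ := (samePolyFun n).mk'_surjective q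
    obtain rfl | ⟨F, hF, hF'⟩ := q.exists_lipschitz_ofReal
    · exact absurd (map_zero _) hq
    · exact ⟨F, hF, fun x => (eval_algebraMap _ _).trans (hF' x)⟩
  have hp : p ≠ 0 := by
    rintro rfl
    rw [map_zero] at h
    exact mul_ne_zero hf (isUnit_algebraMap hs).ne_zero h
  obtain ⟨F, ⟨K, hK⟩, hF⟩ := main p hp
  obtain ⟨G, ⟨L, hL⟩, hG⟩ := main s hs
  refine ⟨_, ⟨_, hK.add hL.neg⟩, ?_⟩
  have : f = algebraMap _ (TropRat n) p * (algebraMap _ (TropRat n) s)⁻¹ := by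
    rw [← h, mul_assoc, mul_inv_cancel₀ (isUnit_algebraMap hs).ne_zero, mul_one]
  rw [this]
  exact hF.mul hG.inv

end TropRat

/-! ### Hoffman's error bound -/

/-- Finitely many lower bounds and upper bounds, all within `δ` of being satisfied by `t`, are
satisfied by a point at distance at most `δ` from `t` if they are consistent. -/
theorem exists_between_abs_sub_le {ι κ : Type} [Fintype ι] {l : ι → ℝ} {u : κ → ℝ} {t δ : ℝ}
    (hδ : 0 ≤ δ) (hlu : ∀ i j, l i ≤ u j) (hl : ∀ i, l i ≤ t + δ) (hu : ∀ j, t - δ ≤ u j) :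
    ∃ s, |t - s| ≤ δ ∧ (∀ i, l i ≤ s) ∧ ∀ j, s ≤ u j := by
  let S : Finset (Option ι) := Finset.univ
  -- The extra lower bound `t - δ` keeps the witness, the largest lower bound, within `δ` of `t`,
  -- and makes the maximum one over a nonempty set.
  let v : Option ι → ℝ := fun o => o.elim (t - δ) l
  have hS : S.Nonempty := ⟨none, Finset.mem_univ _⟩
  have hv : ∀ o, v o ≤ S.sup' hS v := fun o => Finset.le_sup' v (Finset.mem_univ o)
  refine ⟨S.sup' hS v, ?_, fun i => hv (some i), fun j => Finset.sup'_le _ _ fun o _ => ?_⟩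
  · have h1 : t - δ ≤ S.sup' hS v := hv none
    have h2 : S.sup' hS v ≤ t + δ := Finset.sup'_le _ _ fun o _ => by
      cases o with
      | none => change t - δ ≤ t + δ; linarith
      | some i => exact hl i
    rw [abs_le]
    constructor <;> linarith
  · cases o with
    | none => exact hu j
    | some i => exact hlu i j

theorem exists_nonneg_forall_le {ι : Type} [Finite ι] (f : ι → ℝ) :
    ∃ M, 0 ≤ M ∧ ∀ i, f i ≤ M := by
  obtain ⟨M, hM⟩ := (Set.finite_range f).bddAbove
  exact ⟨max M 0, le_max_right _ _, fun i => (hM ⟨i, rfl⟩).trans (le_max_left _ _)⟩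

theorem sum_mul_sub_le {n : ℕ} (c x y : Fin n → ℝ) {r : ℝ} (h : ∀ i, |x i - y i| ≤ r) :
    |∑ i, c i * x i - ∑ i, c i * y i| ≤ (∑ i, |c i|) * r := by
  rw [← Finset.sum_sub_distrib, Finset.sum_mul]
  refine (Finset.abs_sum_le_sum_abs _ _).trans (Finset.sum_le_sum fun i _ => ?_)
  rw [← mul_sub, abs_mul]
  exact mul_le_mul_of_nonneg_left (h i) (abs_nonneg _)

/-- Hoffman's error bound: a point violating the inequalities of a consistent system by at most
`ε` lies within a constant multiple of `ε` of a solution. The proof is by Fourier–Motzkin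
elimination. -/
theorem hoffman_error_bound (n : ℕ) : ∀ (ι : Type) [Fintype ι] (c : ι → Fin n → ℝ) (a : ι → ℝ),
    (∃ y : Fin n → ℝ, ∀ j, ∑ i, c j i * y i + a j ≤ 0) →
    ∃ C : ℝ, 0 ≤ C ∧ ∀ (x : Fin n → ℝ) (ε : ℝ), 0 ≤ ε →
      (∀ j, ∑ i, c j i * x i + a j ≤ ε) →
      ∃ y : Fin n → ℝ, (∀ j, ∑ i, c j i * y i + a j ≤ 0) ∧ ∀ i, |x i - y i| ≤ C * ε := by
  induction n with
  | zero =>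
    rintro ι _ c a ⟨y, hy⟩
    exact ⟨0, le_rfl, fun x ε _ _ => ⟨y, hy, fun i => i.elim0⟩⟩
  | succ n ih =>
    rintro ι _ c a ⟨y₀, hy₀⟩
    classical
    let Pos := {j : ι // 0 < c j 0}
    let Neg := {j : ι // c j 0 < 0}
    let Zer := {j : ι // c j 0 = 0}
    -- Each pair of rows with opposite signs is combined with the positive weights `c q.1 0` and `-c
    -- q.2 0`, which cancels the variable of index 0.
    let c' : (Pos × Neg) ⊕ Zer → Fin n → ℝ := Sum.elim
      (fun q i => c q.2 i.succ * c q.1 0 - c q.1 i.succ * c q.2 0) (fun q i => c q i.succ)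
    let a' : (Pos × Neg) ⊕ Zer → ℝ := Sum.elim
      (fun q => a q.2 * c q.1 0 - a q.1 * c q.2 0) (fun q => a q)
    have hpair (q : Pos × Neg) (y : Fin n → ℝ) :
        ∑ i, c' (Sum.inl q) i * y i + a' (Sum.inl q) =
          (∑ i, c q.2 i.succ * y i + a q.2) * c q.1 0
            - (∑ i, c q.1 i.succ * y i + a q.1) * c q.2 0 := by
      simp only [c', a', Sum.elim_inl, add_mul, Finset.sum_mul, sub_mul, Finset.sum_sub_distrib]
      have h1 : ∀ p r : ι, ∑ i : Fin n, c p i.succ * c r 0 * y i =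
          ∑ i : Fin n, c p i.succ * y i * c r 0 := fun p r =>
        Finset.sum_congr rfl fun i _ => by ring
      rw [h1, h1]
      ring
    have hcons (t : ℝ) (j : ι) (y : Fin n → ℝ) :
        ∑ i, c j i * (Fin.cons t y : Fin (n + 1) → ℝ) i + a j =
          c j 0 * t + (∑ i, c j i.succ * y i + a j) := by
      rw [Fin.sum_univ_succ]
      simp only [Fin.cons_zero, Fin.cons_succ]
      ring
    -- A combined row inherits the violation ε multiplied by the sum of its two weights; a row
    -- without the variable of index 0 keeps ε.
    obtain ⟨M, hM0, hM⟩ := exists_nonneg_forall_le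
      (Sum.elim (fun q => c q.1 0 - c q.2 0) (fun _ => 1) : (Pos × Neg) ⊕ Zer → ℝ)
    have relax (x : Fin (n + 1) → ℝ) (ε : ℝ) (hε : 0 ≤ ε)
        (hx : ∀ j, ∑ i, c j i * x i + a j ≤ ε) (q : (Pos × Neg) ⊕ Zer) :
        ∑ i, c' q i * x (Fin.succ i) + a' q ≤ M * ε := by
      refine le_trans ?_ (mul_le_mul_of_nonneg_right (hM q) hε)
      rcases q with q | q
      · rw [hpair q fun i => x i.succ, Sum.elim_inl]
        have h1 := hx q.1
        have h2 := hx q.2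
        rw [Fin.sum_univ_succ] at h1 h2
        have h3 := mul_le_mul_of_nonneg_right h2 q.1.2.le
        have h4 := mul_le_mul_of_nonpos_right h1 q.2.2.le
        linarith
      · have h1 := hx q
        rw [Fin.sum_univ_succ, q.2] at h1
        simp only [c', a', Sum.elim_inr]
        linarith
    obtain ⟨C, hC0, hC⟩ := ih ((Pos × Neg) ⊕ Zer) c' a'
      ⟨fun i => y₀ i.succ, fun q => by simpa using relax y₀ 0 le_rfl hy₀ q⟩
    -- Moving the other coordinates by at most C·M·ε raises the violation of row j to at most (1 +
    -- Σ|c j i|·C·M)·ε; dividing by |c j 0| gives the shift needed in coordinate 0. Rows with `c j 0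
    -- = 0` contribute the harmless value of a division by zero.
    obtain ⟨D, hD0, hD⟩ := exists_nonneg_forall_le
      fun j => (1 + (∑ i : Fin n, |c j i.succ|) * (C * M)) / |c j 0|
    refine ⟨max (C * M) D, hD0.trans (le_max_right _ _), fun x ε hε hx => ?_⟩
    obtain ⟨y, hy, hxy⟩ := hC (fun i => x i.succ) (M * ε) (mul_nonneg hM0 hε) (relax x ε hε hx)
    have hdev (j : ι) (hj : c j 0 ≠ 0) :
        c j 0 * x 0 + (∑ i, c j i.succ * y i + a j) ≤ |c j 0| * (D * ε) := by
      have h1 := hx j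
      rw [Fin.sum_univ_succ] at h1
      have h2 := (abs_le.mp (sum_mul_sub_le (fun i : Fin n => c j i.succ)
        (fun i => x i.succ) y hxy)).1
      have h3 := mul_le_mul_of_nonneg_right (hD j) hε
      rw [div_mul_eq_mul_div, div_le_iff₀ (abs_pos.mpr hj)] at h3
      linarith
    -- With `y` fixed, negative rows bound coordinate 0 from below and positive rows from above; the
    -- eliminated system says that these bounds are consistent.
    obtain ⟨s, hs, hsl, hsu⟩ := exists_between_abs_sub_le
      (l := fun j : Neg => -(∑ i, c j i.succ * y i + a j) / c j 0)
      (u := fun j : Pos => -(∑ i, c j i.succ * y i + a j) / c j 0) (t := x 0) (δ := D * ε)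
      (mul_nonneg hD0 hε)
      (fun j k => by
        rw [div_le_iff_of_neg j.2, div_mul_eq_mul_div, div_le_iff₀ k.2]
        have := hy (Sum.inl (k, j))
        rw [hpair] at this
        linarith)
      (fun j => by
        rw [div_le_iff_of_neg j.2]
        have := hdev j j.2.ne
        rw [abs_of_neg j.2] at this
        linarith)
      (fun j => by
        rw [le_div_iff₀ j.2]
        have := hdev j j.2.ne'
        rw [abs_of_pos j.2] at this
        linarith)
    refine ⟨Fin.cons s y, fun j => ?_, fun i => ?_⟩
    · rw [hcons]
      rcases lt_trichotomy (c j 0) 0 with hj | hj | hj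
      · have := hsl ⟨j, hj⟩
        rw [div_le_iff_of_neg hj] at this
        linarith
      · have := hy (Sum.inr ⟨j, hj⟩)
        simp only [c', a', Sum.elim_inr] at this
        rw [hj]
        linarith
      · have := hsu ⟨j, hj⟩
        rw [le_div_iff₀ hj] at this
        linarith
    · refine Fin.cases ?_ (fun i => ?_) i
      · exact hs.trans (mul_le_mul_of_nonneg_right (le_max_right _ _) hε)
      · refine (hxy i).trans ?_
        rw [← mul_assoc]
        exact mul_le_mul_of_nonneg_right (le_max_left _ _) hε

/-! ### Finite unions and intersections of polyhedral sets -/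

namespace IsFiniteUnionRationalPolyhedral

variable {n : ℕ} {A B : Set (Fin n → ℝ)}

theorem empty : IsFiniteUnionRationalPolyhedral (∅ : Set (Fin n → ℝ)) :=
  ⟨∅, Set.finite_empty, fun _ h => h.elim, Set.sUnion_empty.symm⟩

theorem of_isRationalPolyhedral (h : IsRationalPolyhedral A) :
    IsFiniteUnionRationalPolyhedral A :=
  ⟨{A}, Set.finite_singleton A, fun _ hP => hP ▸ h, (Set.sUnion_singleton A).symm⟩

theorem univ : IsFiniteUnionRationalPolyhedral (Set.univ : Set (Fin n → ℝ)) :=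
  of_isRationalPolyhedral ⟨0, fun j => j.elim0, fun j => j.elim0,
    (Set.eq_univ_of_forall fun _ j => j.elim0).symm⟩

theorem halfspace (c : Fin n → ℚ) (a : ℝ) :
    IsFiniteUnionRationalPolyhedral {x : Fin n → ℝ | ∑ i, (c i : ℝ) * x i + a ≤ 0} :=
  of_isRationalPolyhedral ⟨1, fun _ => c, fun _ => a, by ext; simp [polyhedron]⟩

theorem union (hA : IsFiniteUnionRationalPolyhedral A) (hB : IsFiniteUnionRationalPolyhedral B) :
    IsFiniteUnionRationalPolyhedral (A ∪ B) := by
  obtain ⟨F, hF, hFP, rfl⟩ := hA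
  obtain ⟨G, hG, hGP, rfl⟩ := hB
  exact ⟨F ∪ G, hF.union hG, fun P hP => hP.elim (hFP P) (hGP P), (Set.sUnion_union F G).symm⟩

theorem _root_.IsRationalPolyhedral.inter (hA : IsRationalPolyhedral A)
    (hB : IsRationalPolyhedral B) : IsRationalPolyhedral (A ∩ B) := by
  obtain ⟨m, c, a, rfl⟩ := hA
  obtain ⟨k, d, b, rfl⟩ := hB
  refine ⟨m + k, Fin.append c d, Fin.append a b, ?_⟩
  ext x
  simp only [polyhedron, Set.mem_inter_iff, Set.mem_ofPred_eq, Fin.forall_fin_add,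
    Fin.append_left, Fin.append_right]

theorem inter (hA : IsFiniteUnionRationalPolyhedral A) (hB : IsFiniteUnionRationalPolyhedral B) :
    IsFiniteUnionRationalPolyhedral (A ∩ B) := by
  obtain ⟨F, hF, hFP, rfl⟩ := hA
  obtain ⟨G, hG, hGP, rfl⟩ := hB
  refine ⟨Set.image2 (· ∩ ·) F G, hF.image2 _ hG, ?_, ?_⟩
  · rintro _ ⟨P, hP, Q, hQ, rfl⟩
    exact (hFP P hP).inter (hGP Q hQ)
  · ext x
    simp only [Set.mem_inter_iff, Set.mem_sUnion, Set.mem_image2]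
    constructor
    · rintro ⟨⟨P, hP, hx⟩, Q, hQ, hx'⟩
      exact ⟨_, ⟨P, hP, Q, hQ, rfl⟩, hx, hx'⟩
    · rintro ⟨_, ⟨P, hP, Q, hQ, rfl⟩, hx, hx'⟩
      exact ⟨⟨P, hP, hx⟩, Q, hQ, hx'⟩

theorem biUnion {ι : Type} {s : Set ι} (hs : s.Finite) {A : ι → Set (Fin n → ℝ)}
    (h : ∀ i ∈ s, IsFiniteUnionRationalPolyhedral (A i)) :
    IsFiniteUnionRationalPolyhedral (⋃ i ∈ s, A i) := by
  induction s, hs using Set.Finite.induction_on with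
  | empty => simpa using empty
  | insert _ _ ih =>
    rw [Set.biUnion_insert]
    exact (h _ (Set.mem_insert _ _)).union (ih fun i hi => h i (Set.mem_insert_of_mem _ hi))

theorem biInter {ι : Type} {s : Set ι} (hs : s.Finite) {A : ι → Set (Fin n → ℝ)}
    (h : ∀ i ∈ s, IsFiniteUnionRationalPolyhedral (A i)) :
    IsFiniteUnionRationalPolyhedral (⋂ i ∈ s, A i) := by
  induction s, hs using Set.Finite.induction_on with
  | empty => simpa using univ
  | insert _ _ ih =>
    rw [Set.biInter_insert]
    exact (h _ (Set.mem_insert _ _)).inter (ih fun i hi => h i (Set.mem_insert_of_mem _ hi))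

end IsFiniteUnionRationalPolyhedral

/-! ### Solution sets of tropical equations -/

/-- The maximum stays a sum in `Trop`, so that p = 0 is covered by the empty sum -∞. -/
theorem MvPolynomial.exists_eval_ofReal_eq_sum {n : ℕ} (p : MvPolynomial (Fin n) Trop) :
    ∃ a : (Fin n →₀ ℕ) → ℝ, ∀ x : Fin n → ℝ, eval (fun i => Trop.ofReal (x i)) p =
      ∑ d ∈ p.support, Trop.ofReal (a d + ∑ i, d i * x i) := by
  have (d : Fin n →₀ ℕ) : ∃ a : ℝ, d ∈ p.support → p.coeff d = Trop.ofReal a := by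
    by_cases hd : d ∈ p.support
    · obtain ⟨a, ha⟩ := (Trop.eq_zero_or_eq_ofReal (p.coeff d)).resolve_left
        (mem_support_iff.mp hd)
      exact ⟨a, fun _ => ha⟩
    · exact ⟨0, fun h => absurd h hd⟩
  choose a ha using this
  refine ⟨a, fun x => ?_⟩
  rw [eval_eq']
  refine Finset.sum_congr rfl fun d hd => ?_
  rw [ha d hd, ← Trop.ofReal_mul]
  congr 1
  have hpow (r : ℝ) (k : ℕ) : Trop.ofReal r ^ k = Trop.ofReal (k * r) := by
    induction k with
    | zero => simp [Trop.ofReal_zero]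
    | succ k ih =>
      rw [pow_succ, ih, Trop.ofReal_mul]
      push_cast
      ring_nf
  have hprod (s : Finset (Fin n)) : ∏ i ∈ s, Trop.ofReal (x i) ^ d i =
      Trop.ofReal (∑ i ∈ s, d i * x i) := by
    induction s using Finset.induction_on with
    | empty => simp [Trop.ofReal_zero]
    | insert i s hi ih =>
      rw [Finset.prod_insert hi, Finset.sum_insert hi, ih, hpow, Trop.ofReal_mul]
  exact hprod _

-- One maximum lies below another when each term of the first lies below some term of the second.
-- Comparing two terms gives a half-space whose slope is a difference of exponents, hence integral.
open IsFiniteUnionRationalPolyhedral in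
theorem MvPolynomial.isFiniteUnionRationalPolyhedral_eval_le {n : ℕ}
    (p q : MvPolynomial (Fin n) Trop) :
    IsFiniteUnionRationalPolyhedral {x : Fin n → ℝ |
      eval (fun i => Trop.ofReal (x i)) p + eval (fun i => Trop.ofReal (x i)) q =
        eval (fun i => Trop.ofReal (x i)) q} := by
  obtain ⟨a, ha⟩ := p.exists_eval_ofReal_eq_sum
  obtain ⟨b, hb⟩ := q.exists_eval_ofReal_eq_sum
  have key : {x : Fin n → ℝ |
      eval (fun i => Trop.ofReal (x i)) p + eval (fun i => Trop.ofReal (x i)) q =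
        eval (fun i => Trop.ofReal (x i)) q} =
      ⋂ d ∈ (p.support : Set (Fin n →₀ ℕ)), ⋃ e ∈ (q.support : Set (Fin n →₀ ℕ)),
        {x | ∑ i, (((d i : ℚ) - e i : ℚ) : ℝ) * x i + (a d - b e) ≤ 0} := by
    ext x
    simp only [Set.mem_ofPred_eq, Set.mem_iInter, Set.mem_iUnion, ha, hb, exists_prop,
      Trop.sum_add_eq_right_iff, Finset.mem_coe]
    refine forall₂_congr fun d _ => ?_
    rw [Trop.add_sum_eq_right_iff _ _ (Trop.zero_ne_ofReal _).symm]
    refine exists_congr fun e => and_congr_right fun _ => ?_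
    rw [Trop.ofReal_add_eq_right]
    push_cast
    simp only [sub_mul, Finset.sum_sub_distrib]
    constructor <;> intro h <;> linarith
  rw [key]
  exact biInter p.support.finite_toSet fun d _ => biUnion q.support.finite_toSet fun e _ =>
    halfspace _ _

/-! ### Two deductions inside a congruence -/

/-- Multiplying `h2` by h gives 1 + h ~ h, to be compared with `h1`. -/
theorem RingCon.rel_one_of_add_one {S : Type} [Semifield S] (c : RingCon S) {h : S}
    (h0 : h ≠ 0) (h1 : c (h + 1) 1) (h2 : c (h⁻¹ + 1) 1) : c h 1 := by
  have h3 := c.mul (c.refl h) h2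
  rw [mul_add, mul_inv_cancel₀ h0, mul_one, add_comm] at h3
  exact c.trans (c.symm h3) h1

/-- h + 1 ~ h + f^N = f^N ~ 1. -/
theorem RingCon.add_one_rel_one {S : Type} [CommSemiring S] (c : RingCon S) {f h : S} {N : ℕ}
    (hf : c f 1) (hN : h + f ^ N = f ^ N) : c (h + 1) 1 := by
  have h1 : c (f ^ N) 1 := by simpa using c.pow N hf
  have h2 := c.add (c.refl h) h1
  rw [hN] at h2
  exact c.trans (c.symm h2) h1

/-! ### The closure of V recovered from generators of E(V) -/

namespace TropRat

variable {n : ℕ}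

theorem isFiniteUnionRationalPolyhedral_eval_eq (f g : TropRat n) :
    IsFiniteUnionRationalPolyhedral {x : Fin n → ℝ | eval x f = eval x g} := by
  obtain ⟨p, s, hs, hf⟩ := f.exists_mul_eq
  obtain ⟨q, t, ht, hg⟩ := g.exists_mul_eq
  have key : {x : Fin n → ℝ | eval x f = eval x g} =
      {x | TropPolyFun.eval x (p * t) = TropPolyFun.eval x (q * s)} := by
    ext x
    have hu : IsUnit (eval x (algebraMap _ (TropRat n) s * algebraMap _ (TropRat n) t)) :=
      ((isUnit_algebraMap hs).mul (isUnit_algebraMap ht)).map _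
    rw [Set.mem_ofPred_eq, Set.mem_ofPred_eq, ← hu.mul_left_inj, ← map_mul (eval x) f,
      ← map_mul (eval x) g, ← eval_algebraMap, ← eval_algebraMap, map_mul _ p, map_mul _ q,
      ← hf, ← hg]
    simp only [mul_assoc, mul_comm (algebraMap _ (TropRat n) t)]
  rw [key]
  obtain ⟨p, hp⟩ := (samePolyFun n).mk'_surjective (p * t)
  obtain ⟨q, hq⟩ := (samePolyFun n).mk'_surjective (q * s)
  rw [← hp, ← hq]
  refine (congrArg IsFiniteUnionRationalPolyhedral (Set.ext fun x => Trop.eq_iff_add_eq)).mpr ?_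
  exact (p.isFiniteUnionRationalPolyhedral_eval_le q).inter
    (q.isFiniteUnionRationalPolyhedral_eval_le p)

/-- Nonzero rational functions are real-valued and continuous; if one side is -∞, the set is empty
or everything. -/
theorem isClosed_eval_eq (f g : TropRat n) : IsClosed {x : Fin n → ℝ | eval x f = eval x g} := by
  by_cases hf : f = 0
  · by_cases hg : g = 0
    · simp [hf, hg]
    · obtain ⟨G, -, hG⟩ := exists_lipschitz_represents hg
      simp [hf, hG _, Trop.zero_ne_ofReal]
  · obtain ⟨F, ⟨K, hK⟩, hF⟩ := exists_lipschitz_represents hf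
    by_cases hg : g = 0
    · simp [hg, hF _, (Trop.zero_ne_ofReal _).symm]
    · obtain ⟨G, ⟨L, hL⟩, hG⟩ := exists_lipschitz_represents hg
      simp only [hF.eval_eq_iff hG]
      exact isClosed_eq hK.continuous hL.continuous

theorem eval_eq_of_mem_closure {V : Set (Fin n → ℝ)} {f g : TropRat n}
    (h : ∀ x ∈ V, eval x f = eval x g) {x : Fin n → ℝ} (hx : x ∈ closure V) :
    eval x f = eval x g :=
  closure_minimal h (isClosed_eval_eq f g) hx

/-- Tropical rational functions separate points from closed sets. -/
theorem exists_eval_eq_one_off_ball (y : Fin n → ℝ) {ε : ℝ} (hε : 0 < ε) :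
    ∃ f : TropRat n, eval y f ≠ 1 ∧ ∀ x, ε ≤ dist x y → eval x f = 1 := by
  -- The tropical sum of the `d (some i)` is the sup-distance to `y`, and the function constructed
  -- below is max(ε - dist(x, y), 0). The index `none` adds the constant 0, so that the maximum
  -- exists for n = 0.
  let d : Option (Fin n) → TropRat n := fun o =>
    o.elim 1 fun i => X i * const (-y i) + (X i * const (-y i))⁻¹
  let D : Option (Fin n) → (Fin n → ℝ) → ℝ := fun o x => o.elim 0 fun i => |x i - y i|
  have hd (o : Option (Fin n)) : Represents (d o) (D o) := by
    cases o with
    | none => exact Represents.one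
    | some i =>
      have h := (Represents.X i).mul (Represents.const (n := n) (-y i))
      intro x
      exact (h.add h.inv) x
  have hS : (Finset.univ : Finset (Option (Fin n))).Nonempty := Finset.univ_nonempty
  have hf := ((Represents.const ε).mul (Represents.sum hS hd).inv).add Represents.one
  refine ⟨const ε * (∑ o, d o)⁻¹ + 1, fun h => ?_, fun x hx => ?_⟩
  · rw [hf y, ← Trop.ofReal_zero, Trop.ofReal_injective.eq_iff, max_eq_right_iff] at h
    have : Finset.univ.sup' hS (fun o => D o y) ≤ 0 := Finset.sup'_le _ _ fun o _ => by
      cases o <;> simp [D]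
    linarith
  · rw [hf x, ← Trop.ofReal_zero]
    congr 1
    refine max_eq_right ?_
    suffices ε ≤ Finset.univ.sup' hS fun o => D o x by linarith
    by_contra! hlt
    rw [Finset.sup'_lt_iff] at hlt
    exact absurd hx (not_le.mpr ((dist_pi_lt_iff hε).mpr fun i => by
      rw [Real.dist_eq]
      exact hlt (some i) (Finset.mem_univ _)))

theorem closure_eq_of_congruence_eq_span {V : Set (Fin n → ℝ)} {G : Set (TropRat n × TropRat n)}
    (h : congruenceSpan G = congruence V) :
    closure V = ⋂ g ∈ G, {x | eval x g.1 = eval x g.2} := by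
  refine Set.Subset.antisymm (Set.subset_iInter₂ fun g hg => ?_) fun y hy => ?_
  · have : congruence V g.1 g.2 := h ▸ RingConGen.Rel.of _ _ hg
    exact fun x hx => eval_eq_of_mem_closure this hx
  · by_contra hyV
    obtain ⟨ε, hε, hball⟩ := Metric.isOpen_iff.mp isClosed_closure.isOpen_compl y hyV
    obtain ⟨f, hfy, hf⟩ := exists_eval_eq_one_off_ball y hε
    have h1 : congruence V f 1 := fun x hx => by
      rw [map_one]
      refine hf x (not_lt.mp fun hlt => hball (Metric.mem_ball.mpr hlt) (subset_closure hx))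
    -- Since `y` solves every generating equation, it solves every equation of E(V), including `f =
    -- 1`, which fails at `y`.
    have h2 : congruenceSpan G ≤ congruence {y} := by
      refine RingCon.ringConGen_le.mpr fun a b hab x hx => ?_
      rw [Set.mem_singleton_iff.mp hx]
      exact Set.mem_iInter₂.mp hy (a, b) hab
    rw [← h] at h1
    exact hfy (by simpa using h2 h1 y rfl)

/-! ### The explicit generator -/

/-- A representing function of `unionGenerator`: pointwise equal to one of the total
violations of the given systems, and at most each of them. -/
theorem exists_represents_unionGenerator {p : ℕ} [NeZero p] (m : Fin p → ℕ)
    (c : (k : Fin p) → Fin (m k) → Fin n → ℤ) (a : (k : Fin p) → Fin (m k) → ℝ) :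
    ∃ F, Represents (unionGenerator m c a) F ∧
      (∀ k x, F x ≤ ∑ j, max (∑ i, c k j i * x i + a k j) 0) ∧
      ∀ x, ∃ k, F x = ∑ j, max (∑ i, c k j i * x i + a k j) 0 := by
  have hS : (Finset.univ : Finset (Fin p)).Nonempty := Finset.univ_nonempty
  let D : Fin p → (Fin n → ℝ) → ℝ := fun k x => ∑ j, max (∑ i, c k j i * x i + a k j) 0
  have hD (k : Fin p) : Represents (∏ j, (const (a k j) * ∏ i, X i ^ c k j i + 1)) (D k) := by
    refine Represents.prod _ fun j x => ?_
    rw [add_comm _ (a k j)]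
    exact ((Represents.const (a k j)).mul (Represents.prod Finset.univ
      fun i => (Represents.X i).zpow (c k j i))).add Represents.one x
  refine ⟨_, (Represents.sum hS fun k => (hD k).inv).inv, fun k x => ?_, fun x => ?_⟩
  · have := Finset.le_sup' (fun k => -D k x) (Finset.mem_univ k)
    exact neg_le.mp this
  · obtain ⟨k, -, hk⟩ := Finset.exists_mem_eq_sup' hS fun k => -D k x
    exact ⟨k, by rw [hk, neg_neg]⟩

theorem congruence_eq_span_unionGenerator {V : Set (Fin n → ℝ)} (p : ℕ) (m : Fin p → ℕ)
    (c : (k : Fin p) → Fin (m k) → Fin n → ℤ) (a : (k : Fin p) → Fin (m k) → ℝ)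
    (hne : ∀ k, (polyhedron (fun j i => (c k j i : ℝ)) (a k)).Nonempty)
    (hV : closure V = ⋃ k, polyhedron (fun j i => (c k j i : ℝ)) (a k)) :
    congruence V = congruenceSpan {(unionGenerator m c a, 1)} ∧
      (V.Nonempty → Ge (unionGenerator m c a) 1) := by
  rcases Nat.eq_zero_or_pos p with rfl | hp
  · obtain rfl : V = ∅ := by
      rw [← closure_empty_iff, hV, Set.iUnion_of_empty]
    refine ⟨le_antisymm (fun f g _ => ?_) fun f g _ x hx => hx.elim, fun h => ?_⟩
    · have h01 : congruenceSpan {(unionGenerator m c a, 1)} 0 1 := by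
        refine RingConGen.Rel.of _ _ ?_
        simp [unionGenerator]
      have h0 (f : TropRat n) : congruenceSpan {(unionGenerator m c a, 1)} 0 f := by
        simpa using RingCon.mul _ h01 (RingCon.refl _ f)
      exact RingCon.trans _ (RingCon.symm _ (h0 f)) (h0 g)
    · exact absurd h Set.not_nonempty_empty
  have : NeZero p := ⟨hp.ne'⟩
  obtain ⟨F, hF, hFle, hFeq⟩ := exists_represents_unionGenerator m c a
  set f := unionGenerator m c a
  have hF0 (x) : 0 ≤ F x := by
    obtain ⟨k, hk⟩ := hFeq x
    rw [hk]
    exact Finset.sum_nonneg fun j _ => le_max_right _ _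
  have hFV (x) (hx : x ∈ closure V) : F x = 0 := by
    rw [hV, Set.mem_iUnion] at hx
    obtain ⟨k, hk⟩ := hx
    exact le_antisymm ((hFle k x).trans_eq
      (Finset.sum_eq_zero fun j _ => max_eq_right (hk j))) (hF0 x)
  -- F(x) is the total violation of one system, which bounds each single violation, so Hoffman's
  -- bound applies with ε = F(x). Its consistency hypothesis is the nonemptiness of that P_k.
  have hbound : ∃ C : ℝ, 0 ≤ C ∧ ∀ x, ∃ y ∈ closure V, dist x y ≤ C * F x := by
    choose C hC0 hC using fun k => hoffman_error_bound n (Fin (m k))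
      (fun j i => (c k j i : ℝ)) (a k) (hne k)
    obtain ⟨M, hM0, hM⟩ := exists_nonneg_forall_le C
    refine ⟨M, hM0, fun x => ?_⟩
    obtain ⟨k, hk⟩ := hFeq x
    obtain ⟨y, hy, hxy⟩ := hC k x (F x) (hF0 x) fun j => by
      rw [hk]
      exact (le_max_left _ _).trans (Finset.single_le_sum
        (f := fun j => max (∑ i, (c k j i : ℝ) * x i + a k j) 0)
        (fun j _ => le_max_right _ _) (Finset.mem_univ j))
    refine ⟨y, hV ▸ Set.mem_iUnion.mpr ⟨k, hy⟩,
      (dist_pi_le_iff (mul_nonneg hM0 (hF0 x))).mpr fun i => ?_⟩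
    rw [Real.dist_eq]
    exact (hxy i).trans (mul_le_mul_of_nonneg_right (hM k) (hF0 x))
  have hspan : congruenceSpan {(f, 1)} f 1 := RingConGen.Rel.of _ _ rfl
  have hone (h : TropRat n) (H : (Fin n → ℝ) → ℝ) (hH : Represents h H)
      (hLip : ∃ K, LipschitzWith K H) (h0 : ∀ x ∈ closure V, H x = 0) :
      congruenceSpan {(f, 1)} (h + 1) 1 := by
    obtain ⟨K, hK⟩ := hLip
    obtain ⟨C, -, hC⟩ := hbound
    -- H vanishes on the closure, so H(x) ≤ K · dist(x, y) ≤ K·C·F(x) ≤ N·F(x) for the nearby point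
    -- y.
    obtain ⟨N, hN⟩ := exists_nat_ge (K * C)
    refine RingCon.add_one_rel_one _ hspan (hH.add_eq_right (hF.pow N) fun x => ?_)
    obtain ⟨y, hy, hxy⟩ := hC x
    have h1 := hK.dist_le_mul x y
    rw [h0 y hy, Real.dist_eq, sub_zero] at h1
    calc H x ≤ K * dist x y := (le_abs_self _).trans h1
      _ ≤ K * (C * F x) := mul_le_mul_of_nonneg_left hxy K.2
      _ = K * C * F x := (mul_assoc _ _ _).symm
      _ ≤ N * F x := mul_le_mul_of_nonneg_right hN (hF0 x)
  have hVne : V.Nonempty := by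
    rw [← closure_nonempty_iff, hV]
    obtain ⟨y, hy⟩ := hne 0
    exact ⟨y, Set.mem_iUnion.mpr ⟨0, hy⟩⟩
  refine ⟨le_antisymm (fun u v huv => ?_) (RingCon.ringConGen_le.mpr ?_), fun _ => ?_⟩
  · obtain ⟨z, hz⟩ := hVne
    -- At the point z of V only the function -∞ takes the value -∞, so it is related only to itself
    -- and division by v is legitimate elsewhere.
    have hzero {u v : TropRat n} (huv : congruence V u v) (hv : v = 0) : u = 0 := by
      by_contra hu
      obtain ⟨U, -, hU⟩ := exists_lipschitz_represents hu
      have := huv z hz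
      rw [hv, map_zero, hU z] at this
      exact Trop.zero_ne_ofReal _ this.symm
    by_cases hv : v = 0
    · rw [hzero huv hv, hv]
      exact RingCon.refl _ _
    have hu : u ≠ 0 := fun hu => hv (hzero (RingCon.symm _ huv) hu)
    obtain ⟨U, ⟨K, hK⟩, hU⟩ := exists_lipschitz_represents hu
    obtain ⟨W, ⟨L, hL⟩, hW⟩ := exists_lipschitz_represents hv
    have hUW (x) (hx : x ∈ closure V) : U x + -W x = 0 := by
      rw [(hU.eval_eq_iff hW x).mp (eval_eq_of_mem_closure huv hx), add_neg_cancel]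
    have h1 := RingCon.rel_one_of_add_one _ (hU.mul hW.inv).ne_zero
      (hone _ _ (hU.mul hW.inv) ⟨_, hK.add hL.neg⟩ hUW)
      (hone _ _ (hU.mul hW.inv).inv ⟨_, (hK.add hL.neg).neg⟩ fun x hx => by rw [hUW x hx, neg_zero])
    simpa [mul_assoc, inv_mul_cancel₀ hv] using RingCon.mul _ h1 (RingCon.refl _ v)
  · rintro _ _ ⟨⟩ x hx
    rw [hF.eval_eq_iff Represents.one]
    exact hFV x (subset_closure hx)
  · change f + 1 = f
    rw [add_comm]
    exact Represents.one.add_eq_right hF hF0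

end TropRat

/-! ### Integral coefficients and the final assembly -/

/-- Clearing denominators. -/
theorem IsRationalPolyhedral.exists_int {n : ℕ} {P : Set (Fin n → ℝ)}
    (h : IsRationalPolyhedral P) : ∃ (m : ℕ) (c : Fin m → Fin n → ℤ) (a : Fin m → ℝ),
      P = polyhedron (fun j i => (c j i : ℝ)) a := by
  obtain ⟨m, c, a, rfl⟩ := h
  have (j : Fin m) : ∃ d : ℤ, 0 < d ∧ ∀ i, ∃ z : ℤ, (z : ℚ) = d * c j i := by
    -- Row j is scaled by the product of its denominators, which is positive and so preserves the
    -- inequality.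
    refine ⟨∏ i, ((c j i).den : ℤ), Finset.prod_pos fun i _ => by exact_mod_cast (c j i).pos,
      fun i => ⟨(∏ k ∈ Finset.univ.erase i, ((c j k).den : ℤ)) * (c j i).num, ?_⟩⟩
    rw [← Finset.prod_erase_mul _ _ (Finset.mem_univ i)]
    push_cast
    rw [mul_assoc, Rat.den_mul_eq_num]
  choose d hd z hz using this
  refine ⟨m, z, fun j => d j * a j, ?_⟩
  ext x
  refine forall_congr' fun j => ?_
  have hd' : (0 : ℝ) < d j := by exact_mod_cast hd j
  have : ∑ i, (z j i : ℝ) * x i + d j * a j = d j * (∑ i, (c j i : ℝ) * x i + a j) := by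
    rw [mul_add, Finset.mul_sum]
    congr 1
    refine Finset.sum_congr rfl fun i _ => ?_
    rw [← mul_assoc]
    congr 1
    exact_mod_cast congrArg (fun q : ℚ => (q : ℝ)) (hz j i)
  rw [this]
  exact ⟨mul_nonpos_of_nonneg_of_nonpos hd'.le, fun h =>
    not_lt.mp fun h' => not_lt.mpr h (mul_pos hd' h')⟩

/-- Empty polyhedra are discarded, since the error bound needs consistent systems; the empty set
becomes p = 0. -/
theorem IsFiniteUnionRationalPolyhedral.exists_int {n : ℕ} {W : Set (Fin n → ℝ)}
    (h : IsFiniteUnionRationalPolyhedral W) : ∃ (p : ℕ) (m : Fin p → ℕ)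
      (c : (k : Fin p) → Fin (m k) → Fin n → ℤ) (a : (k : Fin p) → Fin (m k) → ℝ),
      (∀ k, (polyhedron (fun j i => (c k j i : ℝ)) (a k)).Nonempty) ∧
      W = ⋃ k, polyhedron (fun j i => (c k j i : ℝ)) (a k) := by
  obtain ⟨F, hF, hFP, rfl⟩ := h
  obtain ⟨p, P, -, hP⟩ := (hF.subset (Set.sep_subset F Set.Nonempty)).fin_param
  have hmem (k : Fin p) : P k ∈ {Q ∈ F | Q.Nonempty} := hP ▸ Set.mem_range_self k
  choose m c a hca using fun k => (hFP _ (hmem k).1).exists_int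
  refine ⟨p, m, c, a, fun k => hca k ▸ (hmem k).2, ?_⟩
  simp only [← hca]
  rw [← Set.sUnion_range, hP]
  ext x
  simp only [Set.mem_sUnion, Set.mem_ofPred_eq]
  exact ⟨fun ⟨Q, hQ, hx⟩ => ⟨Q, ⟨hQ, x, hx⟩, hx⟩, fun ⟨Q, hQ, hx⟩ => ⟨Q, hQ.1, hx⟩⟩

/-- Points of `ℝⁿ` are functions `Fin n → ℝ`, whose product topology is the Euclidean one. -/
theorem theorem1p1 (n : ℕ) (V : Set (Fin n → ℝ)) :
    (CongruenceFG (TropRat.congruence V) ↔ IsFiniteUnionRationalPolyhedral (closure V)) ∧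
    (IsFiniteUnionRationalPolyhedral (closure V) → V.Nonempty →
      ∃ f : TropRat n, TropRat.Ge f 1 ∧ TropRat.congruence V = congruenceSpan {(f, 1)}) ∧
    (∀ (p : ℕ) (m : Fin p → ℕ) (c : (k : Fin p) → Fin (m k) → Fin n → ℤ)
      (a : (k : Fin p) → Fin (m k) → ℝ),
      (∀ k, (polyhedron (fun j i => (c k j i : ℝ)) (a k)).Nonempty) →
      closure V = ⋃ k, polyhedron (fun j i => (c k j i : ℝ)) (a k) →
      TropRat.congruence V = congruenceSpan {(unionGenerator m c a, 1)} ∧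
      (V.Nonempty → TropRat.Ge (unionGenerator m c a) 1)) := by

  refine ⟨⟨?_, fun h => ?_⟩, fun h hne => ?_, fun p m c a =>
    TropRat.congruence_eq_span_unionGenerator p m c a⟩
  · rintro ⟨G, hG, h⟩
    rw [TropRat.closure_eq_of_congruence_eq_span h]
    exact .biInter hG fun g _ => TropRat.isFiniteUnionRationalPolyhedral_eval_eq g.1 g.2
  · obtain ⟨p, m, c, a, hne, hV⟩ := h.exists_int
    exact ⟨_, Set.finite_singleton _,
      (TropRat.congruence_eq_span_unionGenerator p m c a hne hV).1.symm⟩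
  · obtain ⟨p, m, c, a, hP, hV⟩ := h.exists_int
    obtain ⟨h1, h2⟩ := TropRat.congruence_eq_span_unionGenerator p m c a hP hV
    exact ⟨_, h2 hne, h1⟩
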